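/- Let $\mathcal{L}$ be a first order language without relation symbols, so that $\mathcal{L}$-structures (with non-empty universe) are $\mathcal{L}$-algebras. Let $\mathcal{Q}$ be a quasivariety of $\mathcal{L}$-algebras, i.e. the class of all $\mathcal{L}$-algebras satisfying some set of quasi-identities $s_1=t_1\wedge\dots\wedge s_m=t_m\rightarrow s=t$ ($m\ge 0$). For an $\mathcal{L}$-algebra $\mathbf{A}$ let $\mathrm{Con}_{\mathcal{Q}}(\mathbf{A})$ be the lattice, ordered by inclusion, of the relative congruences of $\mathbf{A}$, i.e. of the congruences $\theta$ of $\mathbf{A}$ with $\mathbf{A}/\theta\in\mathcal{Q}$. Suppose that $\mathcal{Q}$ is relatively congruence distributive, i.e. $\mathrm{Con}_{\mathcal{Q}}(\mathbf{A})$ is a distributive lattice for every $\mathbf{A}\in\mathcal{Q}$. Let $\mathcal{Q}_{RS}$ be the class of relatively simple members of $\mathcal{Q}$, i.e. of those $\mathbf{A}\in\mathcal{Q}$ for which $\mathrm{Con}_{\mathcal{Q}}(\mathbf{A})$ has exactly two elements (the identity relation and $A\times A$, and these are distinct). Let $\mathcal{K}$ be a universal class of $\mathcal{L}$-algebras, i.e.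 the class of all $\mathcal{L}$-algebras satisfying some set of universal sentences, and suppose that $\mathcal{K}\subseteq\mathcal{Q}_{RS}$. Let $\varphi(\vec{x})$, $\vec{x}=(x_1,\dots,x_n)$, be an open (i.e. quantifier-free) $\mathcal{L}$-formula, where there is at least one $\mathcal{L}$-term in the variables $\vec{x}$ (that is, $n\ge 1$ or $\mathcal{L}$ has a constant symbol). Then there are $r\ge 1$ and $\mathcal{L}$-terms $p_i(\vec{x}),q_i(\vec{x})$, $i=1,\dots,r$, such that $$\mathcal{K}\vDash \varphi(\vec{x})\leftrightarrow\bigwedge_{i=1}^{r}p_i(\vec{x})=q_i(\vec{x}).$$ -/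

import Mathlib

universe u v w

/-- A class of `L`-structures (bundled, in a universe large enough for `L`). -/
abbrev AlgClass (L : FirstOrder.Language.{u, v}) :=
  Set (CategoryTheory.Bundled.{max u v w} L.Structure)

/-- A universal class: the nonempty models of a set of universal sentences. -/
def IsUniversalClass {L : FirstOrder.Language.{u, v}} (K : AlgClass.{u, v, w} L) : Prop :=
  ∃ T : L.Theory, T.IsUniversal ∧ ∀ A, A ∈ K ↔ Nonempty A ∧ A ⊨ T

/-- A quasi-identity `s₁ = t₁ ∧ … ∧ sₘ = tₘ → s = t` (with `m ≥ 0`), in the variables indexed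
by `ℕ`. -/
structure QuasiIdentity (L : FirstOrder.Language.{u, v}) where
  premises : List (L.Term ℕ × L.Term ℕ)
  conclusion : L.Term ℕ × L.Term ℕ

/-- The quasi-identity holds in `A` under all assignments of its variables. -/
def QuasiIdentity.Holds {L : FirstOrder.Language.{u, v}} (e : QuasiIdentity L) (A : Type*)
    [L.Structure A] : Prop :=
  ∀ a : ℕ → A, (∀ s ∈ e.premises, s.1.realize a = s.2.realize a) →
    e.conclusion.1.realize a = e.conclusion.2.realize a

/-- A quasivariety: the class of nonempty models of a set of quasi-identities. -/
structure Quasivariety (L : FirstOrder.Language.{u, v}) where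
  carrier : AlgClass.{u, v, w} L
  axiomatizable : ∃ E : Set (QuasiIdentity L),
    ∀ A, A ∈ carrier ↔ Nonempty A ∧ ∀ e ∈ E, e.Holds A

/-- A congruence: an equivalence relation compatible with the basic operations. -/
@[ext] structure AlgCongruence (L : FirstOrder.Language.{u, v}) (A : Type*) [L.Structure A] extends
    Setoid A where
  compat : ∀ {n : ℕ} (f : L.Functions n) (x y : Fin n → A), (∀ i, r (x i) (y i)) →
    r (FirstOrder.Language.Structure.funMap f x) (FirstOrder.Language.Structure.funMap f y)

namespace AlgCongruence

/-- Congruences are ordered by inclusion. -/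
instance {L : FirstOrder.Language.{u, v}} {A : Type*} [L.Structure A] :
    PartialOrder (AlgCongruence L A) where
  le θ δ := ∀ a b, θ.r a b → δ.r a b
  le_refl _ _ _ h := h
  le_trans _ _ _ h₁ h₂ a b h := h₂ a b (h₁ a b h)
  le_antisymm θ δ h₁ h₂ := by
    apply AlgCongruence.ext
    funext a b
    exact propext ⟨h₁ a b, h₂ a b⟩

/-- The intersection of a set of congruences (`A × A` for the empty set). -/
instance {L : FirstOrder.Language.{u, v}} {A : Type*} [L.Structure A] :
    InfSet (AlgCongruence L A) where
  sInf S :=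
    { r := fun a b => ∀ θ ∈ S, θ.r a b
      iseqv := ⟨fun a θ _ => θ.iseqv.refl a, fun h θ hθ => θ.iseqv.symm (h θ hθ),
        fun h₁ h₂ θ hθ => θ.iseqv.trans (h₁ θ hθ) (h₂ θ hθ)⟩
      compat := fun f x y h θ hθ => θ.compat f x y fun i => h i θ hθ }

/-- The operations of an algebra pass to its quotient. -/
@[reducible] def prestructure {L : FirstOrder.Language.{u, v}} [L.IsAlgebraic] {A : Type*} [S : L.Structure A]
    (θ : AlgCongruence L A) : L.Prestructure θ.toSetoid where
  toStructure := S
  fun_equiv {_ f} x y h := θ.compat f x y h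
  rel_equiv {_ R} _ _ _ := isEmptyElim R

/-- The quotient algebra `A / θ`. -/
def quotient {L : FirstOrder.Language.{u, v}} [L.IsAlgebraic] {A : Type w} [L.Structure A]
    (θ : AlgCongruence L A) : CategoryTheory.Bundled.{w} L.Structure :=
  ⟨Quotient θ.toSetoid, @FirstOrder.Language.quotientStructure L A θ.toSetoid θ.prestructure⟩

/-- A quotient `A / θ` satisfies the quasi-identity `e` iff `e` holds in `A` modulo `θ`. -/
theorem holds_quotient_iff {L : FirstOrder.Language.{u, v}} [L.IsAlgebraic] {A : Type w} [L.Structure A]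
    (θ : AlgCongruence L A) (e : QuasiIdentity L) :
    e.Holds θ.quotient ↔ ∀ a : ℕ → A,
      (∀ s ∈ e.premises, θ.r (s.1.realize a) (s.2.realize a)) →
        θ.r (e.conclusion.1.realize a) (e.conclusion.2.realize a) := by
  let _ := θ.prestructure
  have key : ∀ (t : L.Term ℕ) (a : ℕ → A),
      @FirstOrder.Language.Term.realize L θ.quotient _ ℕ (fun i => Quotient.mk θ.toSetoid (a i)) t =
        Quotient.mk θ.toSetoid (t.realize a) :=
    fun t a => FirstOrder.Language.Term.realize_quotient_mk' θ.toSetoid t a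
  have key₂ : ∀ (s t : L.Term ℕ) (a : ℕ → A),
      @FirstOrder.Language.Term.realize L θ.quotient _ ℕ (fun i => Quotient.mk θ.toSetoid (a i)) s =
        @FirstOrder.Language.Term.realize L θ.quotient _ ℕ (fun i => Quotient.mk θ.toSetoid (a i)) t ↔
      θ.r (s.realize a) (t.realize a) := by
    intro s t a
    rw [key, key]
    exact Quotient.eq
  constructor
  · intro h a ha
    exact (key₂ _ _ a).1 (h _ fun s hs => (key₂ _ _ a).2 (ha s hs))
  · intro h a ha
    obtain ⟨b, rfl⟩ : ∃ b : ℕ → A, a = fun i => Quotient.mk θ.toSetoid (b i) :=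
      ⟨fun i => Quotient.out (s := θ.toSetoid) (a i),
        funext fun i => (Quotient.out_eq (s := θ.toSetoid) (a i)).symm⟩
    exact (key₂ _ _ b).2 (h b fun s hs => (key₂ _ _ b).1 (ha s hs))

end AlgCongruence

namespace Quasivariety

/-- The set `Con_Q(A)` of relative congruences of `A`: those `θ` with `A / θ` in `Q`,
ordered by inclusion. -/
abbrev RelCon {L : FirstOrder.Language.{u, v}} [L.IsAlgebraic] (Q : Quasivariety.{u, v, w} L)
    (A : Type (max u v w)) [L.Structure A] :=
  {θ : AlgCongruence L A // θ.quotient ∈ Q.carrier}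

/-- Relative congruences are closed under intersections. -/
theorem sInf_quotient_mem {L : FirstOrder.Language.{u, v}} [L.IsAlgebraic] (Q : Quasivariety.{u, v, w} L)
    (A : Type (max u v w)) [L.Structure A] [hA : Nonempty A] (S : Set (AlgCongruence L A))
    (hS : ∀ θ ∈ S, θ.quotient ∈ Q.carrier) : (sInf S).quotient ∈ Q.carrier := by
  obtain ⟨E, hE⟩ := Q.axiomatizable
  refine (hE _).2 ⟨hA.map (Quotient.mk (sInf S).toSetoid), fun e he => ?_⟩
  rw [AlgCongruence.holds_quotient_iff]
  intro a ha θ hθ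
  exact (AlgCongruence.holds_quotient_iff θ e).1 (((hE _).1 (hS θ hθ)).2 e he) a
    fun s hs => ha s hs θ hθ

instance {L : FirstOrder.Language.{u, v}} [L.IsAlgebraic] (Q : Quasivariety.{u, v, w} L)
    (A : Type (max u v w)) [L.Structure A] [Nonempty A] : InfSet (Q.RelCon A) where
  sInf S := ⟨sInf (Subtype.val '' S), Q.sInf_quotient_mem A _ (by
    rintro _ ⟨θ, _, rfl⟩
    exact θ.2)⟩

/-- The lattice `Con_Q(A)`: meets are intersections, and a join is the least relative
congruence above the given ones. -/
instance {L : FirstOrder.Language.{u, v}} [L.IsAlgebraic] (Q : Quasivariety.{u, v, w} L)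
    (A : Type (max u v w)) [L.Structure A] [Nonempty A] : CompleteLattice (Q.RelCon A) :=
  completeLatticeOfInf _ fun S =>
    ⟨fun θ hθ _ _ h => h θ.1 ⟨θ, hθ, rfl⟩, fun δ hδ a b h => by
      rintro _ ⟨θ, hθ, rfl⟩
      exact hδ hθ a b h⟩

/-- `Q` is relatively congruence distributive: `Con_Q(A)` is a distributive lattice for all
`A` in `Q`. -/
def RelativelyCongruenceDistributive {L : FirstOrder.Language.{u, v}} [L.IsAlgebraic]
    (Q : Quasivariety.{u, v, w} L) : Prop :=
  ∀ A ∈ Q.carrier, ∀ [Nonempty A], ∀ α β γ : Q.RelCon A, α ⊓ (β ⊔ γ) = (α ⊓ β) ⊔ (α ⊓ γ)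

/-- The class of relatively simple members of `Q`: those `A` in `Q` such that `Con_Q(A)` has
exactly two elements, its least and its greatest one. -/
def relativelySimple {L : FirstOrder.Language.{u, v}} [L.IsAlgebraic] (Q : Quasivariety.{u, v, w} L) :
    AlgClass.{u, v, w} L :=
  {A | A ∈ Q.carrier ∧ ∃ _ : Nonempty A, IsSimpleOrder (Q.RelCon A)}

end Quasivariety

/-! Let Σ be the set of equations in the given variables that φ implies throughout K. By compactness
(`exists_finset_realize`) it is enough that Σ implies φ in K (`realize_of_realize_equations`); this
is a Jónsson-style argument.

Let `a` satisfy Σ in M ∈ K, let B be the free algebra of Q on n generators, and let μ be the kernel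
of the map h : B → M sending the generators to `a`. Subalgebras of M lie in K and so are relatively
simple, hence μ is a coatom of Con_Q(B). Let θ_i be the kernels of the maps g_i from B into members
of K at whose generator images φ holds. That `a` satisfies Σ means ⋂ θ_i ≤ μ. By distributivity the
coatom μ is meet-prime, so the index sets J with ⋂_{i∈J} θ_i ≤ μ contain all members of some
ultrafilter U. The induced map k from B to the ultraproduct over U satisfies φ by Łoś, and ker k ≤
μ. But ker k is a coatom too, so ker k = μ; an open formula sees only the kernel, so φ holds at `a`.
-/

open FirstOrder Language Filter

/-! ### Closure properties of universal classes -/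

namespace IsUniversalClass

variable {L : FirstOrder.Language.{u, v}} {K : AlgClass.{u, v, w} L}

/-- Universal classes are closed under ultraproducts. -/
theorem ultraproduct_mem (hK : IsUniversalClass K) {ι : Type (max u v w)} (U : Ultrafilter ι)
    (A : ι → CategoryTheory.Bundled.{max u v w} L.Structure) (hA : ∀ i, A i ∈ K) :
    (⟨(U : Filter ι).Product fun i => A i, inferInstance⟩ :
      CategoryTheory.Bundled.{max u v w} L.Structure) ∈ K := by
  obtain ⟨T, -, hT⟩ := hK
  have : ∀ i, Nonempty (A i) := fun i => ((hT _).1 (hA i)).1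
  refine (hT _).2 ⟨Ultraproduct.Product.instNonempty, ⟨fun σ hσ => ?_⟩⟩
  exact (Ultraproduct.sentence_realize σ).2
    (Eventually.of_forall fun i => ((hT _).1 (hA i)).2.realize_of_mem σ hσ)

/-- Universal classes are closed under nonempty subalgebras. -/
theorem substructure_mem (hK : IsUniversalClass K)
    {A : CategoryTheory.Bundled.{max u v w} L.Structure} (hA : A ∈ K) (S : L.Substructure A)
    (hS : Nonempty S) :
    (⟨S, inferInstance⟩ : CategoryTheory.Bundled.{max u v w} L.Structure) ∈ K := by
  obtain ⟨T, hTu, hT⟩ := hK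
  have := ((hT _).1 hA).2
  exact (hT _).2 ⟨hS, Theory.IsUniversal.models_of_embedding S.subtype⟩

end IsUniversalClass

/-- The algebra of terms. -/
instance {L : FirstOrder.Language.{u, v}} {X : Type*} : L.Structure (L.Term X) where
  funMap f ts := .func f ts
  RelMap _ _ := False

/-! ### Kernels, images and quotients -/

namespace AlgCongruence

variable {L : FirstOrder.Language.{u, v}}

/-- The kernel of a homomorphism. -/
def ker {A B : Type*} [L.Structure A] [L.Structure B] (h : A →[L] B) : AlgCongruence L A where
  toSetoid := Setoid.ker h
  compat f x y hxy := by
    change h _ = h _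
    rw [h.map_fun, h.map_fun]
    exact congrArg _ (funext hxy)

theorem ker_rel {A B : Type*} [L.Structure A] [L.Structure B] (h : A →[L] B) (x y : A) :
    (ker h).r x y ↔ h x = h y := Iff.rfl

/-- The image of a congruence containing the kernel under a surjective homomorphism. -/
def image {A B : Type*} [L.Structure A] [L.Structure B] (h : A →[L] B)
    (hs : Function.Surjective h) (δ : AlgCongruence L A) (hδ : ker h ≤ δ) : AlgCongruence L B where
  r x y := ∃ a b, h a = x ∧ h b = y ∧ δ.r a b
  iseqv := by
    refine ⟨fun x => ?_, ?_, ?_⟩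
    · obtain ⟨a, rfl⟩ := hs x
      exact ⟨a, a, rfl, rfl, δ.iseqv.refl a⟩
    · rintro _ _ ⟨a, b, rfl, rfl, hab⟩
      exact ⟨b, a, rfl, rfl, δ.iseqv.symm hab⟩
    · rintro _ _ _ ⟨a, b, rfl, rfl, hab⟩ ⟨c, d, hc, rfl, hcd⟩
      exact ⟨a, d, rfl, rfl, δ.iseqv.trans hab (δ.iseqv.trans (hδ _ _ hc.symm) hcd)⟩
  compat f x y hxy := by
    choose a b ha hb hab using hxy
    refine ⟨_, _, ?_, ?_, δ.compat f a b hab⟩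
    · rw [h.map_fun]
      exact congrArg _ (funext ha)
    · rw [h.map_fun]
      exact congrArg _ (funext hb)

theorem image_rel {A B : Type*} [L.Structure A] [L.Structure B] (h : A →[L] B)
    (hs : Function.Surjective h) (δ : AlgCongruence L A) (hδ : ker h ≤ δ) (a b : A) :
    (image h hs δ hδ).r (h a) (h b) ↔ δ.r a b := by
  constructor
  · rintro ⟨c, d, hc, hd, hcd⟩
    exact δ.iseqv.trans (hδ _ _ hc.symm) (δ.iseqv.trans hcd (hδ _ _ hd))
  · exact fun hab => ⟨a, b, rfl, rfl, hab⟩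

variable [L.IsAlgebraic]

/-- Assignments in B lift along the surjection, and the image relates h-values exactly when δ
relates their preimages. -/
theorem holds_quotient_image {A B : Type w} [L.Structure A] [L.Structure B] (h : A →[L] B)
    (hs : Function.Surjective h) (δ : AlgCongruence L A) (hδ : ker h ≤ δ) (e : QuasiIdentity L)
    (he : e.Holds δ.quotient) : e.Holds (image h hs δ hδ).quotient := by
  rw [holds_quotient_iff] at he ⊢
  intro b hb
  obtain ⟨a, rfl⟩ := hs.comp_left b
  simp only [HomClass.realize_term, image_rel] at hb ⊢
  exact he a hb

theorem holds_quotient_ker {A B : Type w} [L.Structure A] [L.Structure B] (h : A →[L] B)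
    (e : QuasiIdentity L) (he : e.Holds B) : e.Holds (ker h).quotient := by
  rw [holds_quotient_iff]
  intro a ha
  simp only [ker_rel, ← HomClass.realize_term] at ha ⊢
  exact he _ ha

/-- The quotient homomorphism. -/
def proj {A : Type w} [L.Structure A] (θ : AlgCongruence L A) : A →[L] θ.quotient where
  toFun := Quotient.mk θ.toSetoid
  map_fun' f x :=
    (@funMap_quotient_mk' L A θ.toSetoid θ.prestructure _ f x).symm
  map_rel' R := isEmptyElim R

theorem proj_surjective {A : Type w} [L.Structure A] (θ : AlgCongruence L A) :
    Function.Surjective θ.proj := Quotient.mk_surjective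

/-- A homomorphism whose kernel contains `θ` factors through the quotient by `θ`. -/
def lift {A : Type w} {B : Type*} [L.Structure A] [L.Structure B] (θ : AlgCongruence L A)
    (h : A →[L] B) (hθ : θ ≤ ker h) : θ.quotient →[L] B where
  toFun := Quotient.lift h hθ
  map_fun' f x := by
    obtain ⟨y, rfl⟩ := θ.proj_surjective.comp_left x
    have : Structure.funMap f (θ.proj ∘ y) = θ.proj (Structure.funMap f y) := (θ.proj.map_fun f y).symm
    rw [this]
    exact h.map_fun f y
  map_rel' R := isEmptyElim R

end AlgCongruence

/-- The value of a quantifier-free formula depends only on the kernel of the evaluation map. -/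
theorem FirstOrder.Language.BoundedFormula.IsQF.realize_comp_iff
    {L : FirstOrder.Language.{u, v}} [L.IsAlgebraic]
    {B M N : Type*} [L.Structure B] [L.Structure M] [L.Structure N] (h : B →[L] M) (g : B →[L] N)
    (hgh : ∀ x y, h x = h y ↔ g x = g y) {α : Type*} {l : ℕ} {φ : L.BoundedFormula α l}
    (hφ : φ.IsQF) (b : α → B) (c : Fin l → B) :
    φ.Realize (h ∘ b) (h ∘ c) ↔ φ.Realize (g ∘ b) (g ∘ c) := by
  induction hφ with
  | falsum => exact Iff.rfl
  | of_isAtomic h' =>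
    cases h' with
    | equal s t =>
      simp only [BoundedFormula.realize_bdEqual, ← Sum.comp_elim, HomClass.realize_term, hgh]
    | rel R => exact isEmptyElim R
  | imp _ _ ih₁ ih₂ => simp only [BoundedFormula.realize_imp, ih₁, ih₂]

/-- The evaluation homomorphism on the term algebra. -/
def FirstOrder.Language.Term.eval {L : FirstOrder.Language.{u, v}} [L.IsAlgebraic] {X A : Type*}
    [L.Structure A] (a : X → A) : L.Term X →[L] A where
  toFun := Term.realize a
  map_fun' _ _ := rfl
  map_rel' R := isEmptyElim R

theorem FirstOrder.Language.Term.realize_var_eq_self {L : FirstOrder.Language.{u, v}} {X : Type*}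
    (t : L.Term X) : t.realize (fun x => (Term.var x : L.Term X)) = t := by
  induction t with
  | var => rfl
  | func f ts ih => exact congrArg (Term.func f) (funext ih)

/-! ### Free algebras and relative coatoms -/

namespace Quasivariety

variable {L : FirstOrder.Language.{u, v}} [L.IsAlgebraic] (Q : Quasivariety.{u, v, w} L)

theorem ker_quotient_mem {A : Type (max u v w)} [L.Structure A] [hA : Nonempty A]
    (B : CategoryTheory.Bundled.{max u v w} L.Structure) (hB : B ∈ Q.carrier) (h : A →[L] B) :
    (AlgCongruence.ker h).quotient ∈ Q.carrier := by
  obtain ⟨E, hE⟩ := Q.axiomatizable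
  exact (hE _).2 ⟨hA.map (AlgCongruence.proj _),
    fun e he => AlgCongruence.holds_quotient_ker h e (((hE _).1 hB).2 e he)⟩

theorem image_quotient_mem {A B : Type (max u v w)} [L.Structure A] [L.Structure B]
    [hB : Nonempty B] (h : A →[L] B)
    (hs : Function.Surjective h) (δ : AlgCongruence L A) (hδ : AlgCongruence.ker h ≤ δ)
    (hQ : δ.quotient ∈ Q.carrier) : (AlgCongruence.image h hs δ hδ).quotient ∈ Q.carrier := by
  obtain ⟨E, hE⟩ := Q.axiomatizable
  exact (hE _).2 ⟨hB.map (AlgCongruence.proj _),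
    fun e he => AlgCongruence.holds_quotient_image h hs δ hδ e (((hE _).1 hQ).2 e he)⟩

/-- A quasivariety has free algebras. -/
theorem exists_free (X : Type) (hX : Nonempty (L.Term X)) :
    ∃ (B : CategoryTheory.Bundled.{max u v w} L.Structure) (b : X → B), B ∈ Q.carrier ∧
      (∀ x, ∃ t : L.Term X, t.realize b = x) ∧
      ∀ A ∈ Q.carrier, ∀ a : X → A, ∃ h : B →[L] A, ∀ i, h (b i) = a i := by
  have : Nonempty (L.Term (ULift.{max v w} X)) := hX.map (Term.relabel ULift.up)
  -- Lifting the variables puts the term algebra in the universe of the algebras of Q; its quotient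
  -- by the least relative congruence is free.
  let F : Type (max u v w) := L.Term (ULift.{max v w} X)
  let ρ : AlgCongruence L F := sInf {θ | θ.quotient ∈ Q.carrier}
  refine ⟨ρ.quotient, fun i => ρ.proj (Term.var ⟨i⟩ : L.Term (ULift.{max v w} X)),
    Q.sInf_quotient_mem F _ fun θ hθ => hθ, fun x => ?_, fun A hA a => ?_⟩
  · obtain ⟨t, rfl⟩ := ρ.proj_surjective x
    refine ⟨Term.relabel ULift.down t, ?_⟩
    rw [Term.realize_relabel]
    exact (HomClass.realize_term ρ.proj).trans (congrArg ρ.proj (Term.realize_var_eq_self t))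
  · let e : F →[L] A := Term.eval fun i => a i.down
    exact ⟨ρ.lift e fun x y hxy => hxy _ (Q.ker_quotient_mem A hA e), fun i => rfl⟩

/-- The kernel of a surjection onto a relatively simple algebra is a relative coatom. -/
theorem isCoatom_ker_of_surjective {B : Type (max u v w)} [L.Structure B] [Nonempty B]
    (A : CategoryTheory.Bundled.{max u v w} L.Structure) (hA : A ∈ Q.relativelySimple)
    (h : B →[L] A) (hs : Function.Surjective h) :
    IsCoatom (⟨AlgCongruence.ker h, Q.ker_quotient_mem A hA.1 h⟩ : Q.RelCon B) := by
  obtain ⟨hAQ, hne, hsimple⟩ := hA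
  have hbot : ∀ x y, (⊥ : Q.RelCon A).1.r x y → x = y := fun x y hxy =>
    (bot_le : (⊥ : Q.RelCon A) ≤
      ⟨AlgCongruence.ker (Hom.id L A), Q.ker_quotient_mem A hAQ _⟩) x y hxy
  have himage : ∀ δ : Q.RelCon B, ∀ hδ : AlgCongruence.ker h ≤ δ.1,
      δ.1 ≤ AlgCongruence.ker h ∨ ∀ x y, δ.1.r x y := by
    intro δ hδ
    rcases hsimple.eq_bot_or_eq_top ⟨_, Q.image_quotient_mem h hs δ.1 hδ δ.2⟩ with h' | h'
    · left
      intro x y hxy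
      apply hbot
      rw [← h']
      exact (AlgCongruence.image_rel h hs δ.1 hδ x y).2 hxy
    · right
      intro x y
      -- The top element is the intersection of the empty family, so it relates everything
      -- vacuously.
      have htop : (⊤ : Q.RelCon A).1.r (h x) (h y) := fun _ ⟨_, hθ, _⟩ => hθ.elim
      rw [← h'] at htop
      exact (AlgCongruence.image_rel h hs δ.1 hδ x y).1 htop
  constructor
  · intro htop
    have : ∀ x y : A, x = y := by
      intro x y
      obtain ⟨a, rfl⟩ := hs x
      obtain ⟨b, rfl⟩ := hs y
      have : (⊤ : Q.RelCon B).1.r a b := fun _ ⟨_, hθ, _⟩ => hθ.elim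
      rw [← htop] at this
      exact this
    -- A one-element algebra has only one congruence, so it is not relatively simple.
    refine bot_ne_top (α := Q.RelCon A) (top_le_iff.1 fun x y _ => ?_)
    rw [this x y]
  · intro δ hδ
    rcases himage δ hδ.le with h' | h'
    · exact absurd h' hδ.not_ge
    · exact top_le_iff.1 fun x y _ => h' x y

end Quasivariety

/-- The kernel of any homomorphism into a member of a universal class of relatively simple
algebras is a relative coatom. -/
theorem IsUniversalClass.isCoatom_ker {L : FirstOrder.Language.{u, v}} [L.IsAlgebraic]
    {K : AlgClass.{u, v, w} L} (hK : IsUniversalClass K) {Q : Quasivariety.{u, v, w} L}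
    (hKQ : K ⊆ Q.relativelySimple) {B : Type (max u v w)} [L.Structure B] [hB : Nonempty B]
    {A : CategoryTheory.Bundled.{max u v w} L.Structure} (hA : A ∈ K) (h : B →[L] A) :
    IsCoatom (⟨AlgCongruence.ker h, Q.ker_quotient_mem A (hKQ hA).1 h⟩ : Q.RelCon B) := by
  let g : B →[L] h.range := Hom.codRestrict h.range h h.mem_range_self
  have hg : Function.Surjective g := by
    rintro ⟨_, x, rfl⟩
    exact ⟨x, rfl⟩
  have hco := Q.isCoatom_ker_of_surjective ⟨h.range, inferInstance⟩
    (hKQ (hK.substructure_mem hA h.range (hB.map g))) g hg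
  have hker : AlgCongruence.ker g = AlgCongruence.ker h := by
    ext x y
    exact Subtype.ext_iff
  simpa only [hker] using hco

/-! ### Prime coatoms and ultrafilters -/

/-- In a distributive lattice with top, coatoms are prime. -/
theorem IsCoatom.le_or_le_of_inf_le {α : Type*} [Lattice α] [OrderTop α]
    (hd : ∀ a b c : α, a ⊓ (b ⊔ c) = (a ⊓ b) ⊔ (a ⊓ c)) {m a b : α} (hm : IsCoatom m)
    (hab : a ⊓ b ≤ m) : a ≤ m ∨ b ≤ m := by
  by_contra! hn
  have htop : b ⊔ m = ⊤ := hm.2 _ (right_lt_sup.2 hn.2)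
  have := hd a b m
  rw [htop, inf_top_eq] at this
  exact hn.1 (this ▸ sup_le hab inf_le_right)

/-- A prime family of sets contains an ultrafilter. -/
theorem Ultrafilter.exists_forall_mem_of_prime {ι : Type*} (D : Set (Set ι)) (huniv : Set.univ ∈ D)
    (hempty : ∅ ∉ D) (hmono : ∀ ⦃J J'⦄, J ⊆ J' → J ∈ D → J' ∈ D)
    (hprime : ∀ J J', J ∪ J' ∈ D → J ∈ D ∨ J' ∈ D) : ∃ U : Ultrafilter ι, ∀ J ∈ U, J ∈ D := by
  -- The sets with complement outside D form a filter. If an ultrafilter refining it had a member J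
  -- ∉ D, it would also contain the complement of J.
  let F : Filter ι :=
    { sets := {J | Jᶜ ∉ D}
      univ_sets := by simpa using hempty
      sets_of_superset := fun hJ hJJ' h => hJ (hmono (Set.compl_subset_compl.2 hJJ') h)
      inter_sets := fun {J J'} hJ hJ' h => by
        rw [Set.compl_inter] at h
        exact (hprime _ _ h).elim hJ hJ' }
  have hF : ∀ J, J ∈ F ↔ Jᶜ ∉ D := fun _ => Iff.rfl
  have : F.NeBot := by
    rw [Filter.neBot_iff, ne_eq, ← Filter.empty_mem_iff_bot, hF]
    simpa using huniv
  refine ⟨Ultrafilter.of F, fun J hJ => ?_⟩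
  by_contra hJD
  refine (Ultrafilter.of F).compl_notMem_iff.2 hJ (Ultrafilter.of_le F ?_)
  rw [hF, _root_.compl_compl]
  exact hJD

/-! ### Compactness and the ultraproduct argument -/

namespace IsUniversalClass

variable {L : FirstOrder.Language.{u, v}} {K : AlgClass.{u, v, w} L}

/-- In a universal class, an elementary consequence of a set of equations is a consequence of
finitely many of them. -/
theorem exists_finset_realize (hK : IsUniversalClass K) {n : ℕ} (φ : L.Formula (Fin n))
    (S : Set (L.Term (Fin n) × L.Term (Fin n)))
    (hS : ∀ A ∈ K, ∀ a : Fin n → A, (∀ s ∈ S, s.1.realize a = s.2.realize a) → φ.Realize a) :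
    ∃ F : Finset (L.Term (Fin n) × L.Term (Fin n)), ↑F ⊆ S ∧
      ∀ A ∈ K, ∀ a : Fin n → A, (∀ s ∈ F, s.1.realize a = s.2.realize a) → φ.Realize a := by
  classical
  by_contra! hn
  let ι : Type (max u v w) := ULift.{max v w} (Finset S)
  have hcounter : ∀ i : ι, ∃ A ∈ K, ∃ a : Fin n → A,
      (∀ s ∈ i.down, s.1.1.realize a = s.1.2.realize a) ∧ ¬ φ.Realize a := by
    intro i
    obtain ⟨A, hA, a, ha, hφ⟩ := hn (i.down.map (Function.Embedding.subtype _)) (by simp)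
    refine ⟨A, hA, a, fun s hs => ha _ ?_, hφ⟩
    exact Finset.mem_map_of_mem (Function.Embedding.subtype _) hs
  choose A hA a ha hφ using hcounter
  have : ∀ i, Nonempty (A i) := by
    obtain ⟨T, -, hT⟩ := hK
    exact fun i => ((hT _).1 (hA i)).1
  -- Each equation of S belongs to eventually all finite subsets, so the ultraproduct of the
  -- counterexamples satisfies all of S.
  let G : Filter ι := (atTop : Filter (Finset S)).comap ULift.down
  have hG : G.NeBot := NeBot.comap_of_surj inferInstance ULift.down_surjective
  let U : Ultrafilter ι := Ultrafilter.of G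
  refine (Ultraproduct.realize_formula_cast (u := U) φ fun j i => a i j).not.2 ?_
    (hS _ (hK.ultraproduct_mem U A hA) _ fun s hs => ?_)
  · intro h
    obtain ⟨i, hi⟩ := h.exists
    exact hφ i hi
  · refine (Ultraproduct.term_realize_cast (fun j i => a i j) s.1).trans
      (Eq.trans (Quotient.sound (Ultrafilter.of_le G ?_))
        (Ultraproduct.term_realize_cast (fun j i => a i j) s.2).symm)
    filter_upwards [preimage_mem_comap (mem_atTop ({⟨s, hs⟩} : Finset S))] with i hi
    exact ha i ⟨s, hs⟩ (hi (Finset.mem_singleton_self _))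

variable [L.IsAlgebraic]

/-- In a universal class of relatively simple algebras of a relatively congruence distributive
quasivariety, a quantifier-free formula follows from the equations it implies. -/
theorem realize_of_realize_equations (hK : IsUniversalClass K) {Q : Quasivariety.{u, v, w} L}
    (hQ : Q.RelativelyCongruenceDistributive) (hKQ : K ⊆ Q.relativelySimple) {n : ℕ}
    (hn : Nonempty (L.Term (Fin n))) {φ : L.Formula (Fin n)} (hφ : φ.IsQF)
    {M : CategoryTheory.Bundled.{max u v w} L.Structure} (hM : M ∈ K) (a : Fin n → M)
    (ha : ∀ p q : L.Term (Fin n),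
      (∀ A ∈ K, ∀ c : Fin n → A, φ.Realize c → p.realize c = q.realize c) →
        p.realize a = q.realize a) : φ.Realize a := by
  obtain ⟨B, b, hBQ, hgen, hfree⟩ := Q.exists_free (Fin n) hn
  have hB : Nonempty B := hn.map (Term.realize b)
  obtain ⟨h, hb⟩ := hfree M (hKQ hM).1 a
  have hmem : ∀ A ∈ K, ∀ g : B →[L] A, (AlgCongruence.ker g).quotient ∈ Q.carrier :=
    fun A hA g => Q.ker_quotient_mem A (hKQ hA).1 g
  let μ : Q.RelCon B := ⟨AlgCongruence.ker h, hmem M hM h⟩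
  have hμ : IsCoatom μ := hK.isCoatom_ker hKQ hM h
  -- Indexing by kernels rather than by the maps themselves keeps the index type in the universe of
  -- the algebras.
  let ι : Type (max u v w) := {θ : Q.RelCon B // ∃ A ∈ K, ∃ g : B →[L] A,
    θ.1 = AlgCongruence.ker g ∧ φ.Realize (g ∘ b)}
  have hι : ∀ i : ι, ∃ A ∈ K, ∃ g : B →[L] A,
    i.1.1 = AlgCongruence.ker g ∧ φ.Realize (g ∘ b) := fun i => i.2
  choose A hA g hg hφg using hι
  have hAne : ∀ i, Nonempty (A i) := fun i => hB.map (g i)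
  let meet : Set ι → Q.RelCon B := fun J => sInf (Subtype.val '' J)
  have hmeet : ∀ J x y, (∀ i ∈ J, g i x = g i y) → (meet J).1.r x y := by
    rintro J x y hxy _ ⟨_, ⟨i, hi, rfl⟩, rfl⟩
    rw [hg i]
    exact hxy i hi
  obtain ⟨U, hU⟩ := Ultrafilter.exists_forall_mem_of_prime {J | meet J ≤ μ}
    (by
      intro x y hxy
      obtain ⟨p, rfl⟩ := hgen x
      obtain ⟨q, rfl⟩ := hgen y
      have hrealize : ∀ t : L.Term (Fin n), h (t.realize b) = t.realize a := fun t => by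
        rw [← HomClass.realize_term, show h ∘ b = a from funext hb]
      change h _ = h _
      rw [hrealize, hrealize]
      refine ha p q fun A' hA' c hc => ?_
      obtain ⟨k, hk⟩ := hfree A' (hKQ hA').1 c
      obtain rfl : k ∘ b = c := funext hk
      rw [HomClass.realize_term, HomClass.realize_term]
      exact hxy (AlgCongruence.ker k)
        ⟨_, ⟨⟨⟨_, hmem A' hA' k⟩, A', hA', k, rfl, hc⟩, trivial, rfl⟩, rfl⟩)
    (by
      intro hle
      refine hμ.1 (top_le_iff.1 ?_)
      simpa [meet] using hle)
    (fun J J' hJJ' hJ =>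
      show meet J' ≤ μ from le_trans (sInf_le_sInf (Set.image_mono hJJ')) hJ)
    (fun J J' hJ => hμ.le_or_le_of_inf_le (hQ B hBQ)
      (by
        simpa only [Set.mem_ofPred_eq, meet, Set.image_union, sInf_union] using hJ))
  let P : CategoryTheory.Bundled.{max u v w} L.Structure :=
    ⟨(U : Filter ι).Product fun i => A i, inferInstance⟩
  have hP : P ∈ K := hK.ultraproduct_mem U A hA
  obtain ⟨k, hk⟩ := hfree P (hKQ hP).1 fun j => ((fun i => g i (b j) : ∀ i, A i) :
    (U : Filter ι).Product fun i => A i)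
  have hk' : k ∘ b = _ := funext hk
  have hφk : φ.Realize (k ∘ b) := by
    rw [hk']
    exact (Ultraproduct.realize_formula_cast (u := U) φ fun j i => g i (b j)).2
      (Eventually.of_forall hφg)
  have hkx : ∀ x, k x = ((fun i => g i x : ∀ i, A i) : (U : Filter ι).Product fun i => A i) := by
    intro x
    obtain ⟨t, rfl⟩ := hgen x
    rw [← HomClass.realize_term, hk']
    refine (Ultraproduct.term_realize_cast (fun j i => g i (b j)) t).trans ?_
    congr 1
    funext i
    exact HomClass.realize_term (g i)
  have hkμ : (⟨AlgCongruence.ker k, hmem P hP k⟩ : Q.RelCon B) ≤ μ := by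
    intro x y hxy
    rw [AlgCongruence.ker_rel, hkx, hkx] at hxy
    have hJ : ∀ᶠ i in (U : Filter ι), g i x = g i y := Quotient.exact hxy
    exact hU _ hJ x y (hmeet _ x y fun i hi => hi)
  -- Only the top and the coatom ker k lie above ker k, and μ is not the top.
  have heq := (hK.isCoatom_ker hKQ hP k).le_iff.1 hkμ |>.resolve_left hμ.1
  have hker : ∀ x y, k x = k y ↔ h x = h y := fun x y => by
    have : (μ.1.r x y) ↔ k x = k y := by rw [heq]; rfl
    exact this.symm
  have := (BoundedFormula.IsQF.realize_comp_iff k h hker hφ b default).1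
    ((Subsingleton.elim (default : Fin 0 → P) (k ∘ default)) ▸ hφk)
  rwa [show h ∘ b = a from funext hb,
    Subsingleton.elim (h ∘ default) (default : Fin 0 → M)] at this

end IsUniversalClass

theorem mainTheorem8 (L : FirstOrder.Language.{u, v}) [L.IsAlgebraic]
    (K : AlgClass.{u, v, w} L) (hK : IsUniversalClass K)
    (Q : Quasivariety.{u, v, w} L) (hQ : Q.RelativelyCongruenceDistributive)
    (hKQ : K ⊆ Q.relativelySimple)
    (n : ℕ) (hn : Nonempty (L.Term (Fin n)))
    (φ : L.Formula (Fin n)) (hφ : φ.IsQF) :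
    ∃ (r : ℕ) (p q : Fin r → L.Term (Fin n)), 1 ≤ r ∧
      ∀ A ∈ K, ∀ a : Fin n → A,
        φ.Realize a ↔ ∀ i : Fin r, (p i).realize a = (q i).realize a := by
  classical
  let S : Set (L.Term (Fin n) × L.Term (Fin n)) :=
    {s | ∀ A ∈ K, ∀ c : Fin n → A, φ.Realize c → s.1.realize c = s.2.realize c}
  obtain ⟨F, hFS, hF⟩ := hK.exists_finset_realize φ S fun A hA a ha =>
    hK.realize_of_realize_equations hQ hKQ hn hφ hA a fun p q hpq => ha (p, q) hpq
  obtain ⟨t⟩ := hn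
  -- The trivial equation t = t guarantees r ≥ 1 even when F is empty.
  let F' := insert (t, t) F
  refine ⟨F'.card, fun i => (F'.equivFin.symm i).1.1, fun i => (F'.equivFin.symm i).1.2,
    Finset.card_pos.2 (Finset.insert_nonempty _ _), fun A hA a => ⟨fun ha i => ?_, fun ha => ?_⟩⟩
  · rcases Finset.mem_insert.1 (F'.equivFin.symm i).2 with h | h
    · change Term.realize a (F'.equivFin.symm i).1.1 = Term.realize a (F'.equivFin.symm i).1.2
      rw [h]
    · exact hFS h A hA a ha
  · refine hF A hA a fun s hs => ?_
    simpa using ha (F'.equivFin ⟨s, Finset.mem_insert_of_mem hs⟩)
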